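/- Let $Q=(-1,1)^3$ and, for an integer $W\ge 0$, let $\mathcal P_W$ be the space of real polynomials $u(\lambda_1,\lambda_2,\lambda_3)$ of degree at most $W$ in each variable separately. Put $$\mathcal B(u)=\|u\|_{H^2(Q)}^2=\int_Q\sum_{|\alpha|\le 2}|D^\alpha u|^2\,d\lambda,\qquad \mathcal C(u)=\int_Q\Big(\sum_{i=1}^3u_{\lambda_i\lambda_i}^2+\sum_{i=1}^3u_{\lambda_i}^2+u^2\Big)d\lambda ,$$ and let $\widetilde{\mathcal C}$ be the symmetric bilinear form induced by $\mathcal C$. Let $L_0,L_1,\dots$ be the Legendre polynomials, and for $b=(\beta_0,\dots,\beta_W)^T$ and $v=\sum_{i=0}^W\beta_iL_i$ let $$\mathcal E(v)=\int_{-1}^1\big((v'')^2+(v')^2\big)\,dt,\qquad \mathcal F(v)=\int_{-1}^1v^2\,dt .$$ Let $E,F$ be the $(W+1)\times(W+1)$ matrices of the bilinear forms induced by $\mathcal E,\mathcal F$ in the basis $L_0,\dots,L_W$. (1) $\mathcal B$ and $\mathcal C$ are spectrally equivalent: there is a constant $L>0$, independent of $W$, such that $$\tfrac1L\,\mathcal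 B(u)\le\mathcal C(u)\le\mathcal B(u)\qquad\text{for all } W\ge 0,\ u\in\mathcal P_W .$$ (2) For every $W\ge0$: $E$ is symmetric, $F$ is symmetric positive definite, and $\mathcal E(v)=b^TEb$, $\mathcal F(v)=b^TFb$ for all $b$. There are real numbers $0\le\mu_0\le\dots\le\mu_W$ and vectors $b_0,\dots,b_W\in\mathbb R^{W+1}$ with $(E-\mu_iF)b_i=0$ and $b_i^TFb_j=\delta_{ij}$. For any real numbers $\mu_i$ and vectors $b_i=(b_{i,0},\dots,b_{i,W})$ satisfying these two relations one has $\mu_i\ge0$ and $b_i^TEb_j=\mu_i\delta_{ij}$; and, with $\phi_i=\sum_{m=0}^Wb_{i,m}L_m$, $\psi_{i,j,k}(\lambda)=\phi_i(\lambda_1)\phi_j(\lambda_2)\phi_k(\lambda_3)$ and $\mu_{i,j,k}=\mu_i+\mu_j+\mu_k+1$ $(0\le i,j,k\le W)$, the polynomials $\psi_{i,j,k}$ form an $L^2(Q)$-orthonormal basis of $\mathcal P_W$ that diagonalizes $\mathcal C$: $$\widetilde{\mathcal C}(\psi_{i,j,k},\psi_{l,m,n})=\mu_{i,j,k}\,\delta_{il}\delta_{jm}\delta_{kn},\qquad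 \widetilde{\mathcal C}(\psi_{i,j,k},v)=\mu_{i,j,k}\int_Q\psi_{i,j,k}\,v\,d\lambda\quad(v\in\mathcal P_W),$$ $$\mathcal C\Big(\sum_{i,j,k}c_{i,j,k}\psi_{i,j,k}\Big)=\sum_{i,j,k}\mu_{i,j,k}\,c_{i,j,k}^2\quad\text{for all real } c_{i,j,k}.$$ -/

import Mathlib

open MeasureTheory

noncomputable section

namespace MasterCube

/-- The master cube `Q = (-1,1)³`. -/
def Q : Set (Fin 3 → ℝ) := Set.univ.pi fun _ => Set.Ioo (-1) 1

/-- The polynomials in `λ₁, λ₂, λ₃` of degree at most `W` in each variable separately. -/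
abbrev PolySpace (W : ℕ) : Submodule ℝ (MvPolynomial (Fin 3) ℝ) :=
  MvPolynomial.restrictDegree (Fin 3) ℝ W

/-- The partial derivative `D^α u` for a multi-index `α`. -/
def multiDeriv (α : Fin 3 → ℕ) (u : MvPolynomial (Fin 3) ℝ) : MvPolynomial (Fin 3) ℝ :=
  (MvPolynomial.pderiv 0)^[α 0] ((MvPolynomial.pderiv 1)^[α 1] ((MvPolynomial.pderiv 2)^[α 2] u))

/-- `𝓑(u) = ‖u‖²_{H²(Q)} = ∫_Q ∑_{|α| ≤ 2} |D^α u|²`; the inner sum is over the multi-indices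
`α ∈ ℕ³` with `|α| = m`. -/
def B (u : MvPolynomial (Fin 3) ℝ) : ℝ :=
  ∫ x in Q, ∑ m ∈ Finset.range 3, ∑ α ∈ Finset.Nat.antidiagonalTuple 3 m,
    |MvPolynomial.eval x (multiDeriv α u)| ^ 2

/-- The bilinear form induced by `𝓒`. -/
def CBilin (f g : MvPolynomial (Fin 3) ℝ) : ℝ :=
  ∫ x in Q,
    ((∑ i : Fin 3, MvPolynomial.eval x (MvPolynomial.pderiv i (MvPolynomial.pderiv i f)) *
        MvPolynomial.eval x (MvPolynomial.pderiv i (MvPolynomial.pderiv i g))) +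
      (∑ i : Fin 3, MvPolynomial.eval x (MvPolynomial.pderiv i f) *
        MvPolynomial.eval x (MvPolynomial.pderiv i g)) +
      MvPolynomial.eval x f * MvPolynomial.eval x g)

/-- `𝓒(u) = ∫_Q (∑ᵢ u_{λᵢλᵢ}² + ∑ᵢ u_{λᵢ}² + u²)`. -/
def C (u : MvPolynomial (Fin 3) ℝ) : ℝ :=
  ∫ x in Q,
    ((∑ i : Fin 3, MvPolynomial.eval x (MvPolynomial.pderiv i (MvPolynomial.pderiv i u)) ^ 2) +
      (∑ i : Fin 3, MvPolynomial.eval x (MvPolynomial.pderiv i u) ^ 2) +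
      MvPolynomial.eval x u ^ 2)

/-- The `L²(Q)` inner product. -/
def L2Q (f g : MvPolynomial (Fin 3) ℝ) : ℝ :=
  ∫ x in Q, MvPolynomial.eval x f * MvPolynomial.eval x g

/-- The Legendre polynomial of degree `n`, by Rodrigues' formula. -/
def legendre (n : ℕ) : Polynomial ℝ :=
  Polynomial.C (1 / (2 ^ n * (n.factorial : ℝ))) *
    Polynomial.derivative^[n] ((Polynomial.X ^ 2 - 1) ^ n)

/-- The polynomial `∑_{i=0}^W bᵢ Lᵢ` with Legendre coefficients `b`. -/
def legendreSum {W : ℕ} (b : Fin (W + 1) → ℝ) : Polynomial ℝ :=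
  ∑ i, Polynomial.C (b i) * legendre i

/-- The bilinear form induced by `𝓔(v) = ∫_{-1}^1 (v''² + v'²)`. -/
def EBilin (f g : Polynomial ℝ) : ℝ :=
  ∫ t in (-1 : ℝ)..1,
    (f.derivative.derivative.eval t * g.derivative.derivative.eval t +
      f.derivative.eval t * g.derivative.eval t)

/-- The bilinear form induced by `𝓕(v) = ∫_{-1}^1 v²`. -/
def FBilin (f g : Polynomial ℝ) : ℝ :=
  ∫ t in (-1 : ℝ)..1, f.eval t * g.eval t

/-- The matrix of `𝓔` in the Legendre basis. -/
def E (W : ℕ) : Matrix (Fin (W + 1)) (Fin (W + 1)) ℝ :=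
  Matrix.of fun i j => EBilin (legendre i) (legendre j)

/-- The matrix of `𝓕` in the Legendre basis. -/
def F (W : ℕ) : Matrix (Fin (W + 1)) (Fin (W + 1)) ℝ :=
  Matrix.of fun i j => FBilin (legendre i) (legendre j)

/-- `(μᵢ)`, `(bᵢ)` is a full system of eigenvalues and `F`-orthonormal eigenvectors of the
generalized symmetric eigenvalue problem `(E - μ F) b = 0`. -/
def IsEigensystem (W : ℕ) (μ : Fin (W + 1) → ℝ) (b : Fin (W + 1) → Fin (W + 1) → ℝ) : Prop :=
  (∀ i, (E W - μ i • F W).mulVec (b i) = 0) ∧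
    ∀ i j, b i ⬝ᵥ (F W).mulVec (b j) = if i = j then 1 else 0

/-- The tensor product polynomial `ψ_{i,j,k}(λ) = φᵢ(λ₁) φⱼ(λ₂) φₖ(λ₃)`, where
`φᵢ = ∑ₘ b_{i,m} Lₘ`. -/
def psi {W : ℕ} (b : Fin (W + 1) → Fin (W + 1) → ℝ)
    (p : Fin (W + 1) × Fin (W + 1) × Fin (W + 1)) : MvPolynomial (Fin 3) ℝ :=
  Polynomial.aeval (MvPolynomial.X 0) (legendreSum (b p.1)) *
    Polynomial.aeval (MvPolynomial.X 1) (legendreSum (b p.2.1)) *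
    Polynomial.aeval (MvPolynomial.X 2) (legendreSum (b p.2.2))

/-- `μ_{i,j,k} = μᵢ + μⱼ + μₖ + 1`. -/
def muTensor {W : ℕ} (μ : Fin (W + 1) → ℝ)
    (p : Fin (W + 1) × Fin (W + 1) × Fin (W + 1)) : ℝ :=
  μ p.1 + μ p.2.1 + μ p.2.2 + 1

end MasterCube

end

/-! The difference `B u - C u` is the sum of the squared `L²` norms of the three mixed second
derivatives, so spectral equivalence amounts to bounding these by pure derivatives. On a domain
where the boundary terms vanish, two integrations by parts give `∫ u_xy² = ∫ u_xx u_yy`, which is at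
most half the sum of the pure squares. A polynomial on the square has boundary terms, so it is first
extended in each variable across both end points by a reflection that matches value and slope there
and is cut off to zero at the outer end. The extended square splits into nine pieces; boundary terms
cancel between neighbouring pieces, and every piece is bounded by pure derivatives on the original
square because the extension in one variable does not differentiate in the other. This is
`Reflection.integral_mixed_deriv_sq_le`. Integrating over the third variable and permuting
coordinates yields `MasterCube.spectral_equivalence`, with a constant that never sees the degree.

For the diagonalization, `C` contains no mixed derivatives, so on tensor products it is the sum of
`E⊗F⊗F`, `F⊗E⊗F`, `F⊗F⊗E` and `F⊗F⊗F` (`CBilin_tensor`). A basis diagonalizing `E` and `F`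
simultaneously in one variable therefore diagonalizes `C`, with eigenvalues `μᵢ + μⱼ + μₖ + 1`. Such
a basis comes from the spectral theorem (`exists_generalized_eigensystem`), and a dimension count
shows that its tensor products span (`span_psi`). -/

/-! ### Extension by reflection in one variable. -/

/-- A weighted two-point reflection: on the interval `[a, 1]` it sends `f` to
`s ↦ (1 - e s²) (α f(p s + q) + β f(r s + t))`. -/
structure Reflection where
  a : ℝ
  e : ℝ
  α : ℝ
  p : ℝ
  q : ℝ
  β : ℝ
  r : ℝ
  t : ℝ

namespace Reflection

/-- The Leibniz coefficients `(j choose i) χ^(j-i)` of the cut-off `χ(s) = 1 - e s²`. -/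
def weight (ρ : Reflection) (j i : Fin 3) (s : ℝ) : ℝ :=
  !![1 - ρ.e * s ^ 2, 0, 0;
    -2 * ρ.e * s, 1 - ρ.e * s ^ 2, 0;
    -2 * ρ.e, 2 * (-2 * ρ.e * s), 1 - ρ.e * s ^ 2] j i

/-- The `j`-th derivative of the reflection of `f 0`, where `f i` is the `i`-th derivative of
`f 0`. -/
def ext (ρ : Reflection) (j : Fin 3) (f : ℕ → ℝ → ℝ) (s : ℝ) : ℝ :=
  ∑ i : Fin 3, ρ.weight j i s *
    (ρ.α * ρ.p ^ (i : ℕ) * f i (ρ.p * s + ρ.q) + ρ.β * ρ.r ^ (i : ℕ) * f i (ρ.r * s + ρ.t))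

lemma continuous_weight (ρ : Reflection) (j i : Fin 3) : Continuous (ρ.weight j i) := by
  unfold weight
  fin_cases j <;> fin_cases i <;> simp <;> fun_prop

@[fun_prop]
lemma continuous_weight_comp {X : Type*} [TopologicalSpace X] (ρ : Reflection) (j i : Fin 3)
    {g : X → ℝ} (hg : Continuous g) : Continuous fun x => ρ.weight j i (g x) :=
  (ρ.continuous_weight j i).comp hg

/-- The data of an extension by reflection: the identity on `[-1, 1]` and one reflection at each
of the end points. -/
def family : Fin 3 → Reflection :=
  -- With `s` the outward distance, `3 - 2 = 1` matches the values at `s = 0`. The slopes match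
  -- since `-3 + 4 = 1` at the right end and `3 - 4 = -1` at the left end, where outward
  -- differentiation reverses the sign. Taking `e = 1` makes the cut-off vanish at `s = 1`. In the
  -- identity entry `β = 0`, and `r = 1` only keeps `|r| ≥ 1` for the change of variables.
  ![⟨-1, 0, 1, 1, 0, 0, 1, 0⟩, ⟨0, 1, 3, -1, 1, -2, -2, 1⟩, ⟨0, 1, 3, 1, -1, -2, 2, -1⟩]

lemma hasDerivAt_comp_affine {f f' : ℝ → ℝ} (hf : ∀ x, HasDerivAt f (f' x) x) (p q s : ℝ) :
    HasDerivAt (fun s => f (p * s + q)) (f' (p * s + q) * p) s := by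
  have h : HasDerivAt (fun s : ℝ => p * s + q) p s := by
    simpa using ((hasDerivAt_id s).const_mul p).add_const q
  exact (hf _).comp s h

lemma hasDerivAt_cutoff (ρ : Reflection) (s : ℝ) :
    HasDerivAt (fun s : ℝ => 1 - ρ.e * s ^ 2) (-2 * ρ.e * s) s := by
  refine (((hasDerivAt_pow 2 s).const_mul ρ.e).const_sub 1).congr_deriv ?_
  norm_num
  ring

lemma hasDerivAt_ext_zero (ρ : Reflection) {f : ℕ → ℝ → ℝ}
    (hf : ∀ i x, HasDerivAt (f i) (f (i + 1) x) x) (s : ℝ) :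
    HasDerivAt (ρ.ext 0 f) (ρ.ext 1 f s) s := by
  have h1 (i : ℕ) := hasDerivAt_comp_affine (hf i) ρ.p ρ.q s
  have h2 (i : ℕ) := hasDerivAt_comp_affine (hf i) ρ.r ρ.t s
  have h3 := ρ.hasDerivAt_cutoff s
  have := h3.mul (((h1 0).const_mul ρ.α).add ((h2 0).const_mul ρ.β))
  refine HasDerivAt.congr_deriv (this.congr_of_eventuallyEq (.of_forall fun x => ?_)) ?_
  · simp [ext, weight, Fin.sum_univ_three]
  · simp only [ext, weight, Fin.sum_univ_three, Pi.add_apply]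
    simp
    ring_nf
    simp

lemma hasDerivAt_ext_one (ρ : Reflection) {f : ℕ → ℝ → ℝ}
    (hf : ∀ i x, HasDerivAt (f i) (f (i + 1) x) x) (s : ℝ) :
    HasDerivAt (ρ.ext 1 f) (ρ.ext 2 f s) s := by
  have h1 (i : ℕ) := hasDerivAt_comp_affine (hf i) ρ.p ρ.q s
  have h2 (i : ℕ) := hasDerivAt_comp_affine (hf i) ρ.r ρ.t s
  have h3 := ρ.hasDerivAt_cutoff s
  have h4 : HasDerivAt (fun s : ℝ => -2 * ρ.e * s) (-2 * ρ.e) s := by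
    simpa using (hasDerivAt_id s).const_mul (-2 * ρ.e)
  have := (h4.mul (((h1 0).const_mul ρ.α).add ((h2 0).const_mul ρ.β))).add
    (h3.mul (((h1 1).const_mul (ρ.α * ρ.p)).add ((h2 1).const_mul (ρ.β * ρ.r))))
  refine HasDerivAt.congr_deriv (this.congr_of_eventuallyEq (.of_forall fun x => ?_)) ?_
  · simp [ext, weight, Fin.sum_univ_three]
  · simp [ext, weight, Fin.sum_univ_three]; ring

@[fun_prop]
lemma continuous_ext (ρ : Reflection) (j : Fin 3) {X : Type*} [TopologicalSpace X]
    {f : X → ℕ → ℝ → ℝ} {g : X → ℝ} (hg : Continuous g)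
    (hf : ∀ i, Continuous fun z : X × ℝ => f z.1 i z.2) :
    Continuous fun x => ρ.ext j (f x) (g x) := by
  have h (i : ℕ) (h : X → ℝ) (hh : Continuous h) : Continuous fun x => f x i (h x) :=
    (hf i).comp (continuous_id.prodMk hh)
  unfold ext
  refine continuous_finsetSum _ fun i _ => (ρ.continuous_weight_comp j i hg).mul ?_
  exact (continuous_const.mul (h _ _ (by fun_prop))).add (continuous_const.mul (h _ _ (by fun_prop)))

/-- Differentiation in a parameter commutes with reflection. -/
lemma hasDerivAt_ext_param (ρ : Reflection) (j : Fin 3) {f : ℝ → ℕ → ℝ → ℝ} {f' : ℕ → ℝ → ℝ}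
    {x : ℝ} (hf : ∀ i y, HasDerivAt (fun x => f x i y) (f' i y) x) (s : ℝ) :
    HasDerivAt (fun x => ρ.ext j (f x) s) (ρ.ext j f' s) x := by
  unfold ext
  exact HasDerivAt.fun_sum fun i _ => (((hf _ _).const_mul _).add ((hf _ _).const_mul _)).const_mul _

/-- Integration by parts on `[-1, 1]` without boundary terms: they are cancelled by those of the
reflections. -/
lemma sum_integral_ext_one_mul_ext_one {f g : ℕ → ℝ → ℝ}
    (hf : ∀ i x, HasDerivAt (f i) (f (i + 1) x) x) (hg : ∀ i x, HasDerivAt (g i) (g (i + 1) x) x) :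
    ∑ k, ∫ s in (family k).a..1, (family k).ext 1 f s * (family k).ext 1 g s =
      -∑ k, ∫ s in (family k).a..1, (family k).ext 2 f s * (family k).ext 0 g s := by
  have cf (i) : Continuous (f i) := continuous_iff_continuousAt.2 fun x => (hf i x).continuousAt
  have cg (i) : Continuous (g i) := continuous_iff_continuousAt.2 fun x => (hg i x).continuousAt
  have key (ρ : Reflection) := intervalIntegral.integral_mul_deriv_eq_deriv_mul (a := ρ.a) (b := 1)
    (fun s _ => ρ.hasDerivAt_ext_one hf s) (fun s _ => ρ.hasDerivAt_ext_zero hg s)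
    (Continuous.intervalIntegrable (ρ.continuous_ext 2 continuous_id
      fun i => (cf i).comp continuous_snd) _ _)
    (Continuous.intervalIntegrable (ρ.continuous_ext 1 continuous_id
      fun i => (cg i).comp continuous_snd) _ _)
  simp only [key]
  -- The boundary terms are `ext 1 f * ext 0 g`. At the outer ends they vanish through the cut-off
  -- in `ext 0 g` alone; at `±1` the matching of value and slope cancels them against those of the
  -- identity.
  simp [family, ext, weight, Fin.sum_univ_three]
  ring

/-- The change of variables contributes a factor `1 / |p| ≤ 1`, and the image interval lies in `[-1,
1]`, where `f` is nonnegative. -/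
lemma integral_comp_affine_le {f : ℝ → ℝ} (hf : Continuous f) (h0 : ∀ x, 0 ≤ f x) {a p q : ℝ}
    (hp : 1 ≤ |p|) (ha : p * a + q ∈ Set.Icc (-1) 1) (h1 : p * 1 + q ∈ Set.Icc (-1) 1) :
    ∫ s in a..1, f (p * s + q) ≤ ∫ x in (-1 : ℝ)..1, f x := by
  have hp0 : p ≠ 0 := by rintro rfl; norm_num at hp
  have hle : |∫ x in p * a + q..p * 1 + q, f x| ≤ |∫ x in (-1 : ℝ)..1, f x| := by
    refine intervalIntegral.abs_integral_mono_interval ?_ (.of_forall h0)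
      (hf.intervalIntegrable _ _)
    rw [Set.uIoc_of_le (by norm_num : (-1 : ℝ) ≤ 1)]
    exact Set.Ioc_subset_Ioc (le_min ha.1 h1.1) (max_le ha.2 h1.2)
  rw [abs_of_nonneg (a := ∫ x in (-1 : ℝ)..1, f x)
    (intervalIntegral.integral_nonneg (by norm_num) fun x _ => h0 x)] at hle
  rw [intervalIntegral.integral_comp_mul_add f hp0, smul_eq_mul]
  refine (le_abs_self _).trans ?_
  rw [abs_mul, abs_inv]
  calc _ ≤ 1 * |∫ x in p * a + q..p * 1 + q, f x| := by
        gcongr; exact inv_le_one_of_one_le₀ hp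
    _ ≤ _ := by rwa [one_mul]

lemma family_affine (k : Fin 3) : (family k).a ≤ 1 ∧ (∀ {f : ℝ → ℝ}, Continuous f → (∀ x, 0 ≤ f x) →
      ∫ s in (family k).a..1, f ((family k).p * s + (family k).q) ≤ ∫ x in (-1 : ℝ)..1, f x) ∧
    ∀ {f : ℝ → ℝ}, Continuous f → (∀ x, 0 ≤ f x) →
      ∫ s in (family k).a..1, f ((family k).r * s + (family k).t) ≤ ∫ x in (-1 : ℝ)..1, f x := by
  refine ⟨?_, fun hf h0 => integral_comp_affine_le hf h0 ?_ ?_ ?_,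
    fun hf h0 => integral_comp_affine_le hf h0 ?_ ?_ ?_⟩ <;>
  fin_cases k <;> norm_num [family]

/-- The constant is `13 = 3² + 2²`, from Cauchy–Schwarz on `3x - 2y`; the cut-off is at most one. -/
lemma ext_zero_sq_le (k : Fin 3) (f : ℕ → ℝ → ℝ) {s : ℝ} (hs : s ∈ Set.Icc (family k).a 1) :
    (family k).ext 0 f s ^ 2 ≤ 13 * (f 0 ((family k).p * s + (family k).q) ^ 2 +
      f 0 ((family k).r * s + (family k).t) ^ 2) := by
  have key (x y : ℝ) (h0 : 0 ≤ s) (h1 : s ≤ 1) :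
      ((1 - s ^ 2) * (3 * x + -(2 * y))) ^ 2 ≤ 13 * (x ^ 2 + y ^ 2) := by
    have h2 : (1 - s ^ 2) ^ 2 ≤ 1 := by
      rw [sq_le_one_iff_abs_le_one, abs_le]; constructor <;> nlinarith
    calc _ = (1 - s ^ 2) ^ 2 * (3 * x - 2 * y) ^ 2 := by ring
      _ ≤ 1 * (3 * x - 2 * y) ^ 2 := by gcongr
      _ ≤ _ := by nlinarith [sq_nonneg (2 * x + 3 * y)]
  fin_cases k
  · simp [family, ext, weight, Fin.sum_univ_three]
    nlinarith [sq_nonneg (f 0 s)]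
  · simp [family] at hs
    simpa [family, ext, weight, Fin.sum_univ_three] using key _ _ hs.1 hs.2
  · simp [family] at hs
    simpa [family, ext, weight, Fin.sum_univ_three] using key _ _ hs.1 hs.2

lemma sq_sum_mul_add_mul_le {c d x y : Fin 3 → ℝ} {M : ℝ} (hc : ∀ i, |c i| ≤ M)
    (hd : ∀ i, |d i| ≤ M) :
    (∑ i, (c i * x i + d i * y i)) ^ 2 ≤ 6 * M ^ 2 * (∑ i, x i ^ 2 + ∑ i, y i ^ 2) := by
  have hc' (i) : c i ^ 2 ≤ M ^ 2 := sq_le_sq' (abs_le.1 (hc i)).1 (abs_le.1 (hc i)).2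
  have hd' (i) : d i ^ 2 ≤ M ^ 2 := sq_le_sq' (abs_le.1 (hd i)).1 (abs_le.1 (hd i)).2
  have := Finset.sum_mul_sq_le_sq_mul_sq Finset.univ (Sum.elim c d) (Sum.elim x y)
  simp only [Fintype.sum_sum_type, Sum.elim_inl, Sum.elim_inr] at this
  rw [Finset.sum_add_distrib]
  refine this.trans (mul_le_mul_of_nonneg_right ?_ (by positivity))
  simp only [Fin.sum_univ_three]
  linarith [hc' 0, hc' 1, hc' 2, hd' 0, hd' 1, hd' 2]

/-- Cauchy–Schwarz over six terms. The bound `16` on the coefficients is attained at `i = 1`, where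
the weight is `-4s` and `β r = 4`. -/
lemma ext_two_sq_le (k : Fin 3) (f : ℕ → ℝ → ℝ) {s : ℝ} (hs : s ∈ Set.Icc (family k).a 1) :
    (family k).ext 2 f s ^ 2 ≤
      6 * 16 ^ 2 * (∑ i : Fin 3, f i ((family k).p * s + (family k).q) ^ 2 +
        ∑ i : Fin 3, f i ((family k).r * s + (family k).t) ^ 2) := by
  have h : (family k).ext 2 f s = ∑ i : Fin 3,
      (((family k).weight 2 i s * (family k).α * (family k).p ^ (i : ℕ)) *
          f i ((family k).p * s + (family k).q) +
        ((family k).weight 2 i s * (family k).β * (family k).r ^ (i : ℕ)) *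
          f i ((family k).r * s + (family k).t)) := by
    unfold ext
    exact Finset.sum_congr rfl fun i _ => by ring
  rw [h]
  clear h
  have hs1 : -1 ≤ s := hs.1.trans' (by fin_cases k <;> simp [family])
  have hs2 : s ≤ 1 := hs.2
  have h2 : s ^ 2 ≤ 1 := by rw [sq_le_one_iff_abs_le_one, abs_le]; exact ⟨hs1, hs2⟩
  have h3 : 0 ≤ s ^ 2 := sq_nonneg s
  refine sq_sum_mul_add_mul_le (fun i => ?_) (fun i => ?_) <;> rw [abs_le] <;>
  fin_cases k <;> fin_cases i <;> simp [family, weight] <;> (try constructor) <;> linarith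

lemma integral_ext_zero_sq_le (k : Fin 3) {f : ℕ → ℝ → ℝ} (hf : ∀ i, Continuous (f i)) :
    ∫ s in (family k).a..1, (family k).ext 0 f s ^ 2 ≤ 26 * ∫ x in (-1 : ℝ)..1, f 0 x ^ 2 := by
  obtain ⟨ha, h1, h2⟩ := family_affine k
  have i1 := h1 ((hf 0).pow 2) fun x => sq_nonneg _
  have i2 := h2 ((hf 0).pow 2) fun x => sq_nonneg _
  have hc : Continuous ((family k).ext 0 f) :=
    (family k).continuous_ext 0 continuous_id fun i => (hf i).comp continuous_snd
  calc _ ≤ ∫ s in (family k).a..1, 13 * (f 0 ((family k).p * s + (family k).q) ^ 2 +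
        f 0 ((family k).r * s + (family k).t) ^ 2) :=
        intervalIntegral.integral_mono_on ha (Continuous.intervalIntegrable (by fun_prop) _ _)
          (Continuous.intervalIntegrable (by fun_prop) _ _) fun s hs => ext_zero_sq_le k f hs
    _ ≤ _ := by
      rw [intervalIntegral.integral_const_mul, intervalIntegral.integral_add
        (Continuous.intervalIntegrable (by fun_prop) _ _)
        (Continuous.intervalIntegrable (by fun_prop) _ _)]
      simp only [Pi.pow_apply] at i1 i2
      linarith

lemma integral_ext_two_sq_le (k : Fin 3) {f : ℕ → ℝ → ℝ} (hf : ∀ i, Continuous (f i)) :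
    ∫ s in (family k).a..1, (family k).ext 2 f s ^ 2 ≤
      3072 * ∫ x in (-1 : ℝ)..1, ∑ i : Fin 3, f i x ^ 2 := by
  obtain ⟨ha, h1, h2⟩ := family_affine k
  have hs : Continuous fun x => ∑ i : Fin 3, f i x ^ 2 := by fun_prop
  have i1 := h1 hs fun x => by positivity
  have i2 := h2 hs fun x => by positivity
  have hc : Continuous ((family k).ext 2 f) :=
    (family k).continuous_ext 2 continuous_id fun i => (hf i).comp continuous_snd
  calc _ ≤ ∫ s in (family k).a..1,
        6 * 16 ^ 2 * (∑ i : Fin 3, f i ((family k).p * s + (family k).q) ^ 2 +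
          ∑ i : Fin 3, f i ((family k).r * s + (family k).t) ^ 2) :=
        intervalIntegral.integral_mono_on ha (Continuous.intervalIntegrable (by fun_prop) _ _)
          (Continuous.intervalIntegrable (by fun_prop) _ _) fun s hs => ext_two_sq_le k f hs
    _ ≤ _ := by
      rw [intervalIntegral.integral_const_mul, intervalIntegral.integral_add
        (Continuous.intervalIntegrable (by fun_prop) _ _)
        (Continuous.intervalIntegrable (by fun_prop) _ _)]
      linarith

attribute [irreducible] weight ext family

end Reflection

/-! ### Mixed derivatives on the square. -/

lemma intervalIntegral_swap {f : ℝ → ℝ → ℝ} (hf : Continuous fun z : ℝ × ℝ => f z.1 z.2)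
    (a b c d : ℝ) :
    ∫ x in a..b, ∫ y in c..d, f x y = ∫ y in c..d, ∫ x in a..b, f x y := by
  refine intervalIntegral_intervalIntegral_swap ?_
  exact (hf.continuousOn.integrableOn_compact (isCompact_uIcc.prod isCompact_uIcc)).mono_set
    (Set.prod_mono Set.uIoc_subset_uIcc Set.uIoc_subset_uIcc)

lemma integral_integral_mono {f g : ℝ → ℝ → ℝ} (hf : Continuous fun z : ℝ × ℝ => f z.1 z.2)
    (hg : Continuous fun z : ℝ × ℝ => g z.1 z.2) {a b c d a' b' : ℝ} (hab : a ≤ b)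
    (h : ∀ x, ∫ y in c..d, f x y ≤ ∫ y in a'..b', g x y) :
    ∫ x in a..b, ∫ y in c..d, f x y ≤ ∫ x in a..b, ∫ y in a'..b', g x y :=
  intervalIntegral.integral_mono hab
    (intervalIntegral.continuous_parametric_intervalIntegral_of_continuous' hf _ _
      |>.intervalIntegrable _ _)
    (intervalIntegral.continuous_parametric_intervalIntegral_of_continuous' hg _ _
      |>.intervalIntegrable _ _) h

namespace Reflection

variable {u : ℕ → ℕ → ℝ → ℝ → ℝ}

/-- The derivative of order `(a, b)` of the reflection `k` in the first and `l` in the second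
variable of `u 0 0`, where `u i j` is the derivative of order `(i, j)` of `u 0 0`. -/
def extProd (u : ℕ → ℕ → ℝ → ℝ → ℝ) (k l a b : Fin 3) (x y : ℝ) : ℝ :=
  (family k).ext a (fun i x => (family l).ext b (fun j y => u i j x y) y) x

lemma extProd_eq (k l a b : Fin 3) (x y : ℝ) :
    extProd u k l a b x y =
      (family l).ext b (fun j y => (family k).ext a (fun i x => u i j x y) x) y := by
  simp only [extProd, ext, Finset.mul_sum, ← Finset.sum_add_distrib]
  rw [Finset.sum_comm]
  exact Finset.sum_congr rfl fun i _ => Finset.sum_congr rfl fun j _ => by ring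

lemma continuous_extProd (hc : ∀ i j, Continuous fun z : ℝ × ℝ => u i j z.1 z.2)
    (k l a b : Fin 3) : Continuous fun z : ℝ × ℝ => extProd u k l a b z.1 z.2 := by
  unfold extProd
  refine continuous_ext _ _ continuous_fst fun i => ?_
  refine continuous_ext _ _ (by fun_prop) fun j => ?_
  exact (hc i j).comp (by fun_prop : Continuous fun z : ((ℝ × ℝ) × ℝ) × ℝ => (z.1.2, z.2))

attribute [irreducible] extProd

/-- For fixed `y`, reflection in `y` is a linear combination with coefficients independent of `x`,
so it turns a sequence of successive `x`-derivatives into another one, and the one-dimensional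
identity applies with `f = g`. -/
lemma sum_integral_extProd_fst (hx : ∀ i j x y, HasDerivAt (fun x => u i j x y) (u (i + 1) j x y) x)
    (hc : ∀ i j, Continuous fun z : ℝ × ℝ => u i j z.1 z.2) (l : Fin 3) :
    ∑ k, ∫ x in (family k).a..1, ∫ y in (family l).a..1, extProd u k l 1 1 x y ^ 2 =
      -∑ k, ∫ x in (family k).a..1, ∫ y in (family l).a..1,
        extProd u k l 2 1 x y * extProd u k l 0 1 x y := by
  have hE := fun k a b => continuous_extProd hc k l a b
  have hE' (k a b) : Continuous fun z : ℝ × ℝ => extProd u k l a b z.2 z.1 :=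
    (hE k a b).comp continuous_swap
  simp_rw [fun k => intervalIntegral_swap (f := fun x y => extProd u k l 1 1 x y ^ 2)
    ((hE k 1 1).pow 2) (family k).a 1 (family l).a 1,
    fun k => intervalIntegral_swap (f := fun x y => extProd u k l 2 1 x y * extProd u k l 0 1 x y)
    ((hE k 2 1).mul (hE k 0 1)) (family k).a 1 (family l).a 1]
  rw [← intervalIntegral.integral_finsetSum, ← intervalIntegral.integral_finsetSum,
    ← intervalIntegral.integral_neg]
  · refine intervalIntegral.integral_congr fun y _ => ?_
    simp only [sq, extProd]
    exact sum_integral_ext_one_mul_ext_one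
      (fun i x => hasDerivAt_ext_param _ _ (fun j y => hx i j x y) _)
      (fun i x => hasDerivAt_ext_param _ _ (fun j y => hx i j x y) _)
  · exact fun k _ => (intervalIntegral.continuous_parametric_intervalIntegral_of_continuous'
      ((hE' k 2 1).mul (hE' k 0 1)) _ _).intervalIntegrable _ _
  · exact fun k _ => (intervalIntegral.continuous_parametric_intervalIntegral_of_continuous'
      ((hE' k 1 1).pow 2) _ _).intervalIntegrable _ _

lemma sum_integral_extProd_snd (hy : ∀ i j x y, HasDerivAt (fun y => u i j x y) (u i (j + 1) x y) y)
    (hc : ∀ i j, Continuous fun z : ℝ × ℝ => u i j z.1 z.2) (k : Fin 3) :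
    ∑ l, ∫ x in (family k).a..1, ∫ y in (family l).a..1,
        extProd u k l 2 1 x y * extProd u k l 0 1 x y =
      -∑ l, ∫ x in (family k).a..1, ∫ y in (family l).a..1,
        extProd u k l 2 0 x y * extProd u k l 0 2 x y := by
  have hE := fun l a b => continuous_extProd hc k l a b
  rw [← intervalIntegral.integral_finsetSum, ← intervalIntegral.integral_finsetSum,
    ← intervalIntegral.integral_neg]
  · refine intervalIntegral.integral_congr fun x _ => ?_
    simp only [extProd_eq]
    -- For fixed `x`, the two factors are the sequences of `y`-derivatives of orders zero and two in
    -- `x`. This choice of `f` and `g` puts the two new derivatives in `y` on the factor of order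
    -- zero in `x`.
    have h := sum_integral_ext_one_mul_ext_one
      (f := fun j y => (family k).ext 0 (fun i x => u i j x y) x)
      (g := fun j y => (family k).ext 2 (fun i x => u i j x y) x)
      (fun j y => hasDerivAt_ext_param (f := fun y i x => u i j x y) _ _ (fun i x => hy i j x y) _)
      (fun j y => hasDerivAt_ext_param (f := fun y i x => u i j x y) _ _ (fun i x => hy i j x y) _)
    simpa only [mul_comm] using h
  · exact fun l _ => (intervalIntegral.continuous_parametric_intervalIntegral_of_continuous'
      ((hE l 2 0).mul (hE l 0 2)) _ _).intervalIntegrable _ _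
  · exact fun l _ => (intervalIntegral.continuous_parametric_intervalIntegral_of_continuous'
      ((hE l 2 1).mul (hE l 0 1)) _ _).intervalIntegrable _ _

/-- The undifferentiated reflection in `y` is removed first, at fixed `x`, at cost `26`, introducing
no `y`-derivative. The reflection in `x` then costs `3072` and leaves only pure `x`-derivatives. -/
lemma integral_extProd_two_zero_sq_le (hc : ∀ i j, Continuous fun z : ℝ × ℝ => u i j z.1 z.2)
    (k l : Fin 3) :
    ∫ x in (family k).a..1, ∫ y in (family l).a..1, extProd u k l 2 0 x y ^ 2 ≤
      26 * (3072 * ∫ x in (-1 : ℝ)..1, ∫ y in (-1 : ℝ)..1, ∑ i : Fin 3, u i 0 x y ^ 2) := by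
  have hk : Continuous fun z : ℝ × ℝ => (family k).ext 2 (fun i x => u i 0 x z.2) z.1 :=
    continuous_ext _ _ continuous_fst fun i =>
      (hc i 0).comp (by fun_prop : Continuous fun z : (ℝ × ℝ) × ℝ => (z.2, z.1.2))
  have hs : Continuous fun z : ℝ × ℝ => ∑ i : Fin 3, u i 0 z.1 z.2 ^ 2 :=
    continuous_finsetSum _ fun i _ => (hc i 0).pow 2
  calc _ ≤ ∫ x in (family k).a..1, ∫ y in (-1 : ℝ)..1,
        26 * (family k).ext 2 (fun i x => u i 0 x y) x ^ 2 := by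
        refine integral_integral_mono ((continuous_extProd hc k l 2 0).pow 2)
          (continuous_const.mul (hk.pow 2)) (family_affine k).1 fun x => ?_
        simp only [extProd_eq]
        rw [intervalIntegral.integral_const_mul]
        refine integral_ext_zero_sq_le l
          (f := fun j y => (family k).ext 2 (fun i x => u i j x y) x) fun j => ?_
        exact continuous_ext _ _ continuous_const fun i =>
          (hc i j).comp (by fun_prop : Continuous fun z : ℝ × ℝ => (z.2, z.1))
    _ = ∫ y in (-1 : ℝ)..1, ∫ x in (family k).a..1,
        26 * (family k).ext 2 (fun i x => u i 0 x y) x ^ 2 :=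
        intervalIntegral_swap (continuous_const.mul (hk.pow 2)) _ _ _ _
    _ ≤ ∫ y in (-1 : ℝ)..1, ∫ x in (-1 : ℝ)..1, 26 * (3072 * ∑ i : Fin 3, u i 0 x y ^ 2) := by
        refine integral_integral_mono ((continuous_const.mul (hk.pow 2)).comp continuous_swap)
          ((continuous_const.mul (continuous_const.mul hs)).comp continuous_swap)
          (by norm_num) fun y => ?_
        simp only [intervalIntegral.integral_const_mul]
        refine mul_le_mul_of_nonneg_left ?_ (by norm_num)
        exact integral_ext_two_sq_le k fun i =>
          (hc i 0).comp (by fun_prop : Continuous fun x : ℝ => (x, y))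
    _ = _ := by
        simp only [intervalIntegral.integral_const_mul]
        rw [intervalIntegral_swap (f := fun x y => ∑ i : Fin 3, u i 0 x y ^ 2) hs]

/-- The previous estimate for the transposed function, since the two reflections commute. -/
lemma integral_extProd_zero_two_sq_le (hc : ∀ i j, Continuous fun z : ℝ × ℝ => u i j z.1 z.2)
    (k l : Fin 3) :
    ∫ x in (family k).a..1, ∫ y in (family l).a..1, extProd u k l 0 2 x y ^ 2 ≤
      26 * (3072 * ∫ x in (-1 : ℝ)..1, ∫ y in (-1 : ℝ)..1, ∑ j : Fin 3, u 0 j x y ^ 2) := by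
  have hs : Continuous fun z : ℝ × ℝ => ∑ j : Fin 3, u 0 j z.1 z.2 ^ 2 :=
    continuous_finsetSum _ fun j _ => (hc 0 j).pow 2
  have h := integral_extProd_two_zero_sq_le (u := fun i j x y => u j i y x)
    (fun i j => (hc j i).comp continuous_swap) l k
  rw [intervalIntegral_swap (f := fun x y => extProd u k l 0 2 x y ^ 2)
    ((continuous_extProd hc k l 0 2).pow 2),
    intervalIntegral_swap (f := fun x y => ∑ j : Fin 3, u 0 j x y ^ 2) hs]
  simp only [extProd_eq (u := u)]
  simpa only [extProd] using h

/-- The mixed second derivative on a square is controlled by the pure derivatives. -/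
lemma integral_mixed_deriv_sq_le
    (hx : ∀ i j x y, HasDerivAt (fun x => u i j x y) (u (i + 1) j x y) x)
    (hy : ∀ i j x y, HasDerivAt (fun y => u i j x y) (u i (j + 1) x y) y)
    (hc : ∀ i j, Continuous fun z : ℝ × ℝ => u i j z.1 z.2) :
    ∫ x in (-1 : ℝ)..1, ∫ y in (-1 : ℝ)..1, u 1 1 x y ^ 2 ≤
      359424 * ((∫ x in (-1 : ℝ)..1, ∫ y in (-1 : ℝ)..1, ∑ i : Fin 3, u i 0 x y ^ 2) +
        ∫ x in (-1 : ℝ)..1, ∫ y in (-1 : ℝ)..1, ∑ j : Fin 3, u 0 j x y ^ 2) := by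
  have h00 : ∫ x in (-1 : ℝ)..1, ∫ y in (-1 : ℝ)..1, u 1 1 x y ^ 2 =
      ∫ x in (family 0).a..1, ∫ y in (family 0).a..1, extProd u 0 0 1 1 x y ^ 2 := by
    simp [extProd, ext, weight, family, Fin.sum_univ_three]
  have hnn (k l : Fin 3) :
      0 ≤ ∫ x in (family k).a..1, ∫ y in (family l).a..1, extProd u k l 1 1 x y ^ 2 :=
    intervalIntegral.integral_nonneg (family_affine k).1 fun x _ =>
      intervalIntegral.integral_nonneg (family_affine l).1 fun y _ => sq_nonneg _
  -- By `ab ≤ (a² + b²) / 2`; the constant is `26 * 3072 / 2`.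
  have hterm (k l : Fin 3) : ∫ x in (family k).a..1, ∫ y in (family l).a..1,
        extProd u k l 2 0 x y * extProd u k l 0 2 x y ≤
      39936 * ((∫ x in (-1 : ℝ)..1, ∫ y in (-1 : ℝ)..1, ∑ i : Fin 3, u i 0 x y ^ 2) +
        ∫ x in (-1 : ℝ)..1, ∫ y in (-1 : ℝ)..1, ∑ j : Fin 3, u 0 j x y ^ 2) := by
    have c1 := continuous_extProd hc k l 2 0
    have c2 := continuous_extProd hc k l 0 2
    have h1 := integral_extProd_two_zero_sq_le hc k l
    have h2 := integral_extProd_zero_two_sq_le hc k l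
    have h3 : ∫ x in (family k).a..1, ∫ y in (family l).a..1,
          extProd u k l 2 0 x y * extProd u k l 0 2 x y ≤
        ∫ x in (family k).a..1, ∫ y in (family l).a..1,
          (1 / 2 * extProd u k l 2 0 x y ^ 2 + 1 / 2 * extProd u k l 0 2 x y ^ 2) := by
      refine integral_integral_mono (c1.mul c2)
        ((continuous_const.mul (c1.pow 2)).add (continuous_const.mul (c2.pow 2)))
        (family_affine k).1 fun x => ?_
      have d1 : Continuous (extProd u k l 2 0 x) := c1.comp (by fun_prop : Continuous fun y => (x, y))
      have d2 : Continuous (extProd u k l 0 2 x) := c2.comp (by fun_prop : Continuous fun y => (x, y))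
      refine intervalIntegral.integral_mono (family_affine l).1
        (Continuous.intervalIntegrable (by fun_prop) _ _)
        (Continuous.intervalIntegrable (by fun_prop) _ _) fun y => ?_
      dsimp only
      nlinarith [sq_nonneg (extProd u k l 2 0 x y - extProd u k l 0 2 x y)]
    have h4 : ∫ x in (family k).a..1, ∫ y in (family l).a..1,
          (1 / 2 * extProd u k l 2 0 x y ^ 2 + 1 / 2 * extProd u k l 0 2 x y ^ 2) =
        1 / 2 * (∫ x in (family k).a..1, ∫ y in (family l).a..1, extProd u k l 2 0 x y ^ 2) +
        1 / 2 * ∫ x in (family k).a..1, ∫ y in (family l).a..1, extProd u k l 0 2 x y ^ 2 := by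
      rw [← intervalIntegral.integral_const_mul, ← intervalIntegral.integral_const_mul,
        ← intervalIntegral.integral_add]
      · refine intervalIntegral.integral_congr fun x _ => ?_
        have d1 : Continuous (extProd u k l 2 0 x) :=
          c1.comp (by fun_prop : Continuous fun y => (x, y))
        have d2 : Continuous (extProd u k l 0 2 x) :=
          c2.comp (by fun_prop : Continuous fun y => (x, y))
        rw [← intervalIntegral.integral_const_mul, ← intervalIntegral.integral_const_mul,
          ← intervalIntegral.integral_add]
        · exact Continuous.intervalIntegrable (by fun_prop) _ _
        · exact Continuous.intervalIntegrable (by fun_prop) _ _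
      · exact (continuous_const.mul (intervalIntegral.continuous_parametric_intervalIntegral_of_continuous'
          (c1.pow 2) _ _)).intervalIntegrable _ _
      · exact (continuous_const.mul (intervalIntegral.continuous_parametric_intervalIntegral_of_continuous'
          (c2.pow 2) _ _)).intervalIntegrable _ _
    linarith
  -- One integration by parts in each variable; the two signs cancel. Only the sum over all nine
  -- pieces is free of boundary terms.
  have hsum : ∑ l, ∑ k, ∫ x in (family k).a..1, ∫ y in (family l).a..1,
        extProd u k l 1 1 x y ^ 2 =
      ∑ k, ∑ l, ∫ x in (family k).a..1, ∫ y in (family l).a..1,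
        extProd u k l 2 0 x y * extProd u k l 0 2 x y := by
    simp only [sum_integral_extProd_fst hx hc, Finset.sum_neg_distrib]
    rw [Finset.sum_comm]
    simp only [sum_integral_extProd_snd hy hc, Finset.sum_neg_distrib, neg_neg]
  rw [h00]
  -- The original square is the piece `k = l = 0`; the other eight are nonnegative and may be added.
  -- The final constant is `9 * 39936`.
  calc _ ≤ ∑ l, ∑ k, ∫ x in (family k).a..1, ∫ y in (family l).a..1,
        extProd u k l 1 1 x y ^ 2 :=
        (Finset.single_le_sum (fun k _ => hnn k 0) (Finset.mem_univ 0)).trans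
          (Finset.single_le_sum (f := fun l => ∑ k, ∫ x in (family k).a..1,
            ∫ y in (family l).a..1, extProd u k l 1 1 x y ^ 2)
            (fun l _ => Finset.sum_nonneg fun k _ => hnn k l) (Finset.mem_univ 0))
    _ ≤ ∑ k : Fin 3, ∑ l : Fin 3,
        39936 * ((∫ x in (-1 : ℝ)..1, ∫ y in (-1 : ℝ)..1, ∑ i : Fin 3, u i 0 x y ^ 2) +
          ∫ x in (-1 : ℝ)..1, ∫ y in (-1 : ℝ)..1, ∑ j : Fin 3, u 0 j x y ^ 2) :=
        hsum.trans_le <| Finset.sum_le_sum fun k _ => Finset.sum_le_sum fun l _ => hterm k l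
    _ = _ := by
        simp only [Finset.sum_const, Finset.card_univ, Fintype.card_fin, nsmul_eq_mul]
        push_cast
        ring

end Reflection

/-! ### Integration of polynomials over the cube and spectral equivalence. -/

noncomputable section
namespace MasterCube

lemma volume_restrict_Q :
    (volume : Measure (Fin 3 → ℝ)).restrict Q =
      Measure.pi fun _ => volume.restrict (Set.Ioo (-1) 1) := by
  rw [Q, volume_pi, Measure.restrict_pi_pi]

lemma integrableOn_eval (p : MvPolynomial (Fin 3) ℝ) :
    IntegrableOn (fun x => MvPolynomial.eval x p) Q := by
  have hc : Continuous fun x : Fin 3 → ℝ => MvPolynomial.eval x p := MvPolynomial.continuous_eval p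
  refine (hc.continuousOn.integrableOn_compact
    (isCompact_univ_pi fun _ => isCompact_Icc (a := (-1 : ℝ)) (b := 1))).mono_set ?_
  exact Set.pi_mono fun _ _ => Set.Ioo_subset_Icc_self

/-- Integration of a polynomial over the cube. -/
def cubeIntegral : MvPolynomial (Fin 3) ℝ →ₗ[ℝ] ℝ where
  toFun p := ∫ x in Q, MvPolynomial.eval x p
  map_add' p q := by
    simp only [map_add]
    exact integral_add (integrableOn_eval p) (integrableOn_eval q)
  map_smul' c p := by
    simp only [MvPolynomial.smul_eval, integral_const_mul, RingHom.id_apply, smul_eq_mul]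

lemma cubeIntegral_apply (p : MvPolynomial (Fin 3) ℝ) :
    cubeIntegral p = ∫ x in Q, MvPolynomial.eval x p := rfl

lemma cubeIntegral_nonneg {p : MvPolynomial (Fin 3) ℝ} (h : ∀ x, 0 ≤ MvPolynomial.eval x p) :
    0 ≤ cubeIntegral p :=
  integral_nonneg h

/-- Fubini's theorem for products of functions of one variable. -/
lemma integral_Q_mul_mul (f g h : ℝ → ℝ) :
    ∫ x in Q, f (x 0) * g (x 1) * h (x 2) =
      (∫ t in (-1 : ℝ)..1, f t) * (∫ t in (-1 : ℝ)..1, g t) * ∫ t in (-1 : ℝ)..1, h t := by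
  rw [volume_restrict_Q]
  have := integral_fin_nat_prod_eq_prod (n := 3) (E := fun _ => ℝ) (𝕜 := ℝ)
    (μ := fun _ => volume.restrict (Set.Ioo (-1) 1)) ![f, g, h]
  simp only [Fin.prod_univ_three] at this
  simpa [intervalIntegral.integral_of_le, integral_Ioc_eq_integral_Ioo] using this

lemma cubeIntegral_monomial (m : Fin 3 →₀ ℕ) (c : ℝ) :
    cubeIntegral (MvPolynomial.monomial m c) = c * ∏ i, ∫ t in (-1 : ℝ)..1, t ^ m i := by
  rw [cubeIntegral_apply, Fin.prod_univ_three, ← integral_Q_mul_mul, ← integral_const_mul]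
  simp [MvPolynomial.eval_monomial, Finsupp.prod_fintype, Fin.prod_univ_three]

/-- By linearity it suffices to treat monomials, whose integrals are products of identical
one-dimensional moments. -/
lemma cubeIntegral_rename (σ : Equiv.Perm (Fin 3)) (p : MvPolynomial (Fin 3) ℝ) :
    cubeIntegral (MvPolynomial.rename σ p) = cubeIntegral p := by
  induction p using MvPolynomial.induction_on' with
  | monomial m c =>
    rw [MvPolynomial.rename_monomial, cubeIntegral_monomial, cubeIntegral_monomial]
    congr 1
    refine (Fintype.prod_equiv σ _ _ fun i => ?_).symm
    rw [Finsupp.mapDomain_apply σ.injective]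
  | add p q hp hq => simp only [map_add, hp, hq]

lemma continuous_eval_vec {X : Type*} [TopologicalSpace X] {f g h : X → ℝ} (hf : Continuous f)
    (hg : Continuous g) (hh : Continuous h) (p : MvPolynomial (Fin 3) ℝ) :
    Continuous fun x => MvPolynomial.eval ![f x, g x, h x] p := by
  refine (MvPolynomial.continuous_eval p).comp (continuous_pi fun i => ?_)
  fin_cases i <;> simpa

lemma continuous_integral_eval_vec (p : MvPolynomial (Fin 3) ℝ) :
    Continuous fun w : ℝ × ℝ => ∫ y in (-1 : ℝ)..1, MvPolynomial.eval ![w.2, y, w.1] p :=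
  intervalIntegral.continuous_parametric_intervalIntegral_of_continuous'
    (continuous_eval_vec (by fun_prop) (by fun_prop) (by fun_prop) p) _ _

lemma continuous_integral_integral_eval_vec (p : MvPolynomial (Fin 3) ℝ) :
    Continuous fun z : ℝ => ∫ x in (-1 : ℝ)..1, ∫ y in (-1 : ℝ)..1,
      MvPolynomial.eval ![x, y, z] p :=
  intervalIntegral.continuous_parametric_intervalIntegral_of_continuous'
    (continuous_integral_eval_vec p) _ _

/-- The third variable is outermost so that the estimate on the square can be applied slice by
slice. -/
lemma cubeIntegral_eq_iterated (p : MvPolynomial (Fin 3) ℝ) :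
    cubeIntegral p = ∫ z in (-1 : ℝ)..1, ∫ x in (-1 : ℝ)..1, ∫ y in (-1 : ℝ)..1,
      MvPolynomial.eval ![x, y, z] p := by
  induction p using MvPolynomial.induction_on' with
  | monomial m c =>
    rw [cubeIntegral_monomial, Fin.prod_univ_three]
    simp [MvPolynomial.eval_monomial, Finsupp.prod_fintype, Fin.prod_univ_three]
  | add p q hp hq =>
    rw [map_add, hp, hq, ← intervalIntegral.integral_add
      ((continuous_integral_integral_eval_vec p).intervalIntegrable _ _)
      ((continuous_integral_integral_eval_vec q).intervalIntegrable _ _)]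
    refine intervalIntegral.integral_congr fun z _ => ?_
    rw [← intervalIntegral.integral_add]
    rotate_left
    · exact ((continuous_integral_eval_vec p).comp
        (by fun_prop : Continuous fun x : ℝ => (z, x))).intervalIntegrable _ _
    · exact ((continuous_integral_eval_vec q).comp
        (by fun_prop : Continuous fun x : ℝ => (z, x))).intervalIntegrable _ _
    refine intervalIntegral.integral_congr fun x _ => ?_
    rw [← intervalIntegral.integral_add]
    rotate_left
    · exact (continuous_eval_vec continuous_const continuous_id
        continuous_const p).intervalIntegrable _ _
    · exact (continuous_eval_vec continuous_const continuous_id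
        continuous_const q).intervalIntegrable _ _
    simp only [map_add]

lemma hasDerivAt_eval_update (w : Fin 3 → ℝ) (i : Fin 3) (p : MvPolynomial (Fin 3) ℝ) (x : ℝ) :
    HasDerivAt (fun t => MvPolynomial.eval (Function.update w i t) p)
      (MvPolynomial.eval (Function.update w i x) (MvPolynomial.pderiv i p)) x := by
  induction p using MvPolynomial.induction_on with
  | C a => simpa using hasDerivAt_const x a
  | add p q hp hq => simpa using hp.fun_add hq
  | mul_X p j hp =>
    have hj : HasDerivAt (fun t => Function.update w i t j) (if j = i then 1 else 0) x := by
      by_cases h : j = i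
      · subst h; simpa using hasDerivAt_id' x
      · simpa [h] using hasDerivAt_const x (w j)
    have := hp.fun_mul hj
    simp only [map_mul, MvPolynomial.eval_X]
    refine this.congr_deriv ?_
    by_cases h : j = i
    · subst h; simp; ring
    · simp [h, MvPolynomial.pderiv_X_of_ne h]; ring

/-- The commutator of two derivations is a derivation, and this one kills every variable. -/
lemma pderiv_comm (i j : Fin 3) (p : MvPolynomial (Fin 3) ℝ) :
    MvPolynomial.pderiv i (MvPolynomial.pderiv j p) =
      MvPolynomial.pderiv j (MvPolynomial.pderiv i p) := by
  have h : ⁅(MvPolynomial.pderiv i : Derivation ℝ (MvPolynomial (Fin 3) ℝ) (MvPolynomial (Fin 3) ℝ)),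
      (MvPolynomial.pderiv j :
        Derivation ℝ (MvPolynomial (Fin 3) ℝ) (MvPolynomial (Fin 3) ℝ))⁆ = 0 := by
    refine MvPolynomial.derivation_ext fun k => ?_
    simp only [Derivation.commutator_apply, MvPolynomial.pderiv_X, Pi.single_apply]
    split_ifs <;> simp
  have := congr($h p)
  rwa [Derivation.commutator_apply, Derivation.zero_apply, sub_eq_zero] at this

/-- The sum of the squares of the derivatives of order at most two in the variable `i`. -/
def pureSq (i : Fin 3) (u : MvPolynomial (Fin 3) ℝ) : MvPolynomial (Fin 3) ℝ :=
  ∑ n : Fin 3, ((MvPolynomial.pderiv i)^[n] u) ^ 2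

lemma cubeIntegral_mixed_le (u : MvPolynomial (Fin 3) ℝ) :
    cubeIntegral (MvPolynomial.pderiv 0 (MvPolynomial.pderiv 1 u) ^ 2) ≤
      359424 * (cubeIntegral (pureSq 0 u) + cubeIntegral (pureSq 1 u)) := by
  have hc (f : MvPolynomial (Fin 3) ℝ) :=
    (continuous_integral_integral_eval_vec f).intervalIntegrable (μ := volume) (-1) 1
  simp only [cubeIntegral_eq_iterated]
  rw [← intervalIntegral.integral_add (hc _) (hc _), ← intervalIntegral.integral_const_mul]
  refine intervalIntegral.integral_mono (by norm_num) (hc _)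
    (((hc _).add (hc _)).const_mul _) fun z => ?_
  have hcomm : Function.Commute (MvPolynomial.pderiv (R := ℝ) (0 : Fin 3))
    (MvPolynomial.pderiv 1) := fun p => pderiv_comm 0 1 p
  have := Reflection.integral_mixed_deriv_sq_le (u := fun i j x y => MvPolynomial.eval ![x, y, z]
    ((MvPolynomial.pderiv 0)^[i] ((MvPolynomial.pderiv 1)^[j] u))) (fun i j x y => ?_)
    (fun i j x y => ?_)
    (fun i j => continuous_eval_vec continuous_fst continuous_snd continuous_const _)
  · simpa [pureSq] using this
  · have h := hasDerivAt_eval_update ![0, y, z] 0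
      ((MvPolynomial.pderiv 0)^[i] ((MvPolynomial.pderiv 1)^[j] u)) x
    have e (t : ℝ) : Function.update ![0, y, z] 0 t = ![t, y, z] := by
      ext k; fin_cases k <;> simp
    simpa only [e, Function.iterate_succ_apply'] using h
  · have h := hasDerivAt_eval_update ![x, 0, z] 1
      ((MvPolynomial.pderiv 0)^[i] ((MvPolynomial.pderiv 1)^[j] u)) y
    rw [Function.iterate_succ_apply', hcomm.iterate_left]
    have e (t : ℝ) : Function.update ![x, 0, z] 1 t = ![x, t, z] := by
      ext k; fin_cases k <;> simp
    simpa only [e] using h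

/-- Renaming the variables by `σ⁻¹` moves the pair `(σ 0, σ 1)` to `(0, 1)` without changing the
integral. -/
lemma cubeIntegral_mixed_perm_le (σ : Equiv.Perm (Fin 3)) (u : MvPolynomial (Fin 3) ℝ) :
    cubeIntegral (MvPolynomial.pderiv (σ 0) (MvPolynomial.pderiv (σ 1) u) ^ 2) ≤
      359424 * (cubeIntegral (pureSq (σ 0) u) + cubeIntegral (pureSq (σ 1) u)) := by
  have h (i : Fin 3) (p : MvPolynomial (Fin 3) ℝ) : MvPolynomial.pderiv i
      (MvPolynomial.rename σ.symm p) = MvPolynomial.rename σ.symm (MvPolynomial.pderiv (σ i) p) := by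
    simpa using MvPolynomial.pderiv_rename σ.symm.injective (σ i) p
  have hi (i : Fin 3) (n : ℕ) (p : MvPolynomial (Fin 3) ℝ) : (MvPolynomial.pderiv i)^[n]
      (MvPolynomial.rename σ.symm p) =
      MvPolynomial.rename σ.symm ((MvPolynomial.pderiv (σ i))^[n] p) := by
    induction n with
    | zero => rfl
    | succ n ih => rw [Function.iterate_succ_apply', ih, h, Function.iterate_succ_apply']
  have := cubeIntegral_mixed_le (MvPolynomial.rename σ.symm u)
  simpa only [pureSq, h, hi, ← map_pow, ← map_sum, cubeIntegral_rename] using this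

/-- The integrand of `CBilin` as a polynomial. -/
def cPoly (f g : MvPolynomial (Fin 3) ℝ) : MvPolynomial (Fin 3) ℝ :=
  (∑ i : Fin 3, MvPolynomial.pderiv i (MvPolynomial.pderiv i f) *
      MvPolynomial.pderiv i (MvPolynomial.pderiv i g)) +
    (∑ i : Fin 3, MvPolynomial.pderiv i f * MvPolynomial.pderiv i g) + f * g

lemma CBilin_eq (f g : MvPolynomial (Fin 3) ℝ) : CBilin f g = cubeIntegral (cPoly f g) := by
  rw [CBilin, cubeIntegral_apply]
  simp only [cPoly, map_add, map_sum, map_mul]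

lemma C_eq_CBilin (u : MvPolynomial (Fin 3) ℝ) : C u = CBilin u u := by
  simp only [C, CBilin, sq]

lemma B_eq (u : MvPolynomial (Fin 3) ℝ) :
    B u = C u + cubeIntegral (MvPolynomial.pderiv 0 (MvPolynomial.pderiv 1 u) ^ 2) +
      cubeIntegral (MvPolynomial.pderiv 0 (MvPolynomial.pderiv 2 u) ^ 2) +
      cubeIntegral (MvPolynomial.pderiv 1 (MvPolynomial.pderiv 2 u) ^ 2) := by
  rw [C_eq_CBilin, CBilin_eq, ← map_add, ← map_add, ← map_add, B, cubeIntegral_apply]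
  refine integral_congr_ae (.of_forall fun x => ?_)
  have h0 : Finset.Nat.antidiagonalTuple 3 0 = {![0, 0, 0]} := by decide
  have h1 : Finset.Nat.antidiagonalTuple 3 1 = {![1, 0, 0], ![0, 1, 0], ![0, 0, 1]} := by decide
  have h2 : Finset.Nat.antidiagonalTuple 3 2 =
    {![2, 0, 0], ![0, 2, 0], ![0, 0, 2], ![1, 1, 0], ![1, 0, 1], ![0, 1, 1]} := by decide
  simp only [Finset.sum_range_succ, Finset.sum_range_zero, h0, h1, h2]
  repeat rw [Finset.sum_insert (by decide)]
  simp [multiDeriv, cPoly, Fin.sum_univ_three]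
  ring

theorem spectral_equivalence : ∃ L : ℝ, 0 < L ∧ ∀ u : MvPolynomial (Fin 3) ℝ,
    1 / L * B u ≤ C u ∧ C u ≤ B u := by
  -- The constant is `1 + 6 * 359424`: three mixed terms, each bounded by two integrals of `pureSq`,
  -- each of which is at most `C u`.
  refine ⟨2156545, by norm_num, fun u => ?_⟩
  have hpos (p : MvPolynomial (Fin 3) ℝ) : 0 ≤ cubeIntegral (p ^ 2) :=
    cubeIntegral_nonneg fun x => by rw [map_pow]; positivity
  have h01 := cubeIntegral_mixed_perm_le 1 u
  have h02 := cubeIntegral_mixed_perm_le (Equiv.swap 1 2) u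
  have h12 := cubeIntegral_mixed_perm_le (finRotate 3) u
  have e1 : Equiv.swap (1 : Fin 3) 2 0 = 0 := by decide
  have e2 : finRotate 3 0 = 1 := by decide
  have e3 : finRotate 3 1 = 2 := by decide
  simp only [Equiv.Perm.one_apply, e1, e2, e3, Equiv.swap_apply_left] at h01 h02 h12
  have hp (i : Fin 3) : cubeIntegral (pureSq i u) ≤ C u := by
    rw [C_eq_CBilin, CBilin_eq]
    simp only [cPoly, pureSq, Fin.sum_univ_three, map_add, ← sq]
    fin_cases i <;> simp <;> linarith [hpos (MvPolynomial.pderiv 0 u),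
      hpos (MvPolynomial.pderiv 1 u), hpos (MvPolynomial.pderiv 2 u),
      hpos (MvPolynomial.pderiv 0 (MvPolynomial.pderiv 0 u)),
      hpos (MvPolynomial.pderiv 1 (MvPolynomial.pderiv 1 u)),
      hpos (MvPolynomial.pderiv 2 (MvPolynomial.pderiv 2 u))]
  have hB := B_eq u
  have h0 := hp 0
  have h1 := hp 1
  have h2 := hp 2
  constructor
  · rw [one_div, inv_mul_le_iff₀ (by norm_num)]
    linarith
  · linarith [hpos (MvPolynomial.pderiv 0 (MvPolynomial.pderiv 1 u)),
      hpos (MvPolynomial.pderiv 0 (MvPolynomial.pderiv 2 u)),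
      hpos (MvPolynomial.pderiv 1 (MvPolynomial.pderiv 2 u))]

end MasterCube
end

/-! ### The generalized eigenvalue problem and the one-dimensional forms. -/

noncomputable section
namespace MasterCube

/-- The generalized symmetric eigenvalue problem for a symmetric and a positive definite matrix
has a full ordered system. -/
theorem exists_generalized_eigensystem {n : ℕ} {A M : Matrix (Fin n) (Fin n) ℝ}
    (hA : A.IsSymm) (hM : M.PosDef) :
    ∃ (μ : Fin n → ℝ) (b : Fin n → Fin n → ℝ), Monotone μ ∧
      (∀ i, (A - μ i • M).mulVec (b i) = 0) ∧
      ∀ i j, b i ⬝ᵥ M.mulVec (b j) = if i = j then 1 else 0 := by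
  obtain ⟨N, hN⟩ : ∃ N : Matrix (Fin n) (Fin n) ℝ, M = N.transpose * N := by
    open scoped MatrixOrder in
    obtain ⟨N, hN⟩ := CStarAlgebra.nonneg_iff_eq_star_mul_self.mp hM.posSemidef.nonneg
    exact ⟨N, by simpa [Matrix.star_eq_conjTranspose] using hN⟩
  have hu : IsUnit N.det := by
    have h := (Matrix.isUnit_iff_isUnit_det _).1 hM.isUnit
    rw [hN, Matrix.det_mul] at h
    exact isUnit_of_mul_isUnit_right h
  -- With `M = NᵀN`, the substitution `v = N b` turns `A b = μ M b` into the ordinary symmetric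
  -- problem `S v = μ v`, and `M`-orthonormality of the `b` into orthonormality of the `v`.
  set S := (N⁻¹).transpose * A * N⁻¹
  have hS : S.IsHermitian := by
    rw [Matrix.IsHermitian, Matrix.conjTranspose_eq_transpose_of_trivial]
    simp [S, Matrix.transpose_mul, hA.eq, Matrix.mul_assoc]
  have hAS : A = N.transpose * S * N := by
    have h1 : N.transpose * (N⁻¹).transpose = 1 := by
      rw [← Matrix.transpose_mul, Matrix.nonsing_inv_mul _ hu, Matrix.transpose_one]
    calc A = (N.transpose * (N⁻¹).transpose) * A * (N⁻¹ * N) := by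
          rw [h1, Matrix.nonsing_inv_mul _ hu, Matrix.one_mul, Matrix.mul_one]
      _ = _ := by simp only [S, Matrix.mul_assoc]
  set σ := Tuple.sort hS.eigenvalues
  set v : Fin n → Fin n → ℝ := fun i => (hS.eigenvectorBasis (σ i)).ofLp
  have hNv (i) : N.mulVec ((N⁻¹).mulVec (v i)) = v i := by
    rw [Matrix.mulVec_mulVec, Matrix.mul_nonsing_inv _ hu, Matrix.one_mulVec]
  refine ⟨hS.eigenvalues ∘ σ, fun i => (N⁻¹).mulVec (v i), Tuple.monotone_sort _, fun i => ?_,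
    fun i j => ?_⟩
  · have h1 : S.mulVec (v i) = hS.eigenvalues (σ i) • v i := hS.mulVec_eigenvectorBasis (σ i)
    clear_value S
    rw [Matrix.sub_mulVec, Matrix.smul_mulVec, hAS, hN]
    simp only [← Matrix.mulVec_mulVec, hNv, h1, Matrix.mulVec_smul, Function.comp_apply, sub_self]
  · rw [hN, ← Matrix.mulVec_mulVec, Matrix.dotProduct_mulVec, Matrix.vecMul_transpose, hNv, hNv]
    have := orthonormal_iff_ite.1 hS.eigenvectorBasis.orthonormal (σ i) (σ j)
    rw [EuclideanSpace.inner_eq_star_dotProduct] at this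
    simpa [v, dotProduct_comm] using this

/-- Differentiating the leading term `X^(2n)` of `(X² - 1)^n` `n` times leaves a nonzero multiple of
`X^n`. -/
lemma degree_legendre (n : ℕ) : (legendre n).degree = n := by
  have hq : ((Polynomial.X ^ 2 - 1 : Polynomial ℝ)).Monic := by
    simpa using Polynomial.monic_X_pow_sub_C (1 : ℝ) two_ne_zero
  have hqd : ((Polynomial.X ^ 2 - 1 : Polynomial ℝ) ^ n).natDegree = n * 2 := by
    rw [hq.natDegree_pow]
    congr 1
    simpa using Polynomial.natDegree_X_pow_sub_C (n := 2) (r := (1 : ℝ))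
  have hc : (Polynomial.derivative^[n] ((Polynomial.X ^ 2 - 1 : Polynomial ℝ) ^ n)).coeff n ≠ 0 := by
    rw [Polynomial.coeff_iterate_derivative, ← two_mul, mul_comm 2, ← hqd,
      Polynomial.coeff_natDegree, (hq.pow n).leadingCoeff, nsmul_one, hqd]
    exact_mod_cast (Nat.descFactorial_pos.2 (by omega)).ne'
  have hle : (Polynomial.derivative^[n] ((Polynomial.X ^ 2 - 1 : Polynomial ℝ) ^ n)).natDegree ≤ n :=
    (Polynomial.natDegree_iterate_derivative _ _).trans (by rw [hqd]; omega)
  rw [legendre, Polynomial.degree_C_mul (by positivity),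
    Polynomial.degree_eq_of_le_of_coeff_ne_zero (Polynomial.natDegree_le_iff_degree_le.1 hle) hc]

/-- The Legendre polynomials as a sequence with exactly one member of each degree. -/
def legendreSequence : Polynomial.Sequence ℝ := ⟨legendre, degree_legendre⟩

lemma legendreSum_eq_zero {W : ℕ} {b : Fin (W + 1) → ℝ} (h : legendreSum b = 0) : b = 0 := by
  have hli : LinearIndependent ℝ fun i : Fin (W + 1) => legendre i :=
    legendreSequence.linearIndependent.comp _ Fin.val_injective
  simp only [legendreSum, ← Polynomial.smul_eq_C_mul] at h
  exact funext (Fintype.linearIndependent_iff.1 hli b h)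

lemma natDegree_legendreSum_le {W : ℕ} (b : Fin (W + 1) → ℝ) : (legendreSum b).natDegree ≤ W := by
  refine Polynomial.natDegree_sum_le_of_forall_le _ _ fun i _ =>
    (Polynomial.natDegree_C_mul_le _ _).trans ?_
  rw [Polynomial.natDegree_eq_of_degree_eq_some (degree_legendre i)]
  omega

/-- Integration of a polynomial over `[-1, 1]`. -/
def segmentIntegral : Polynomial ℝ →ₗ[ℝ] ℝ where
  toFun p := ∫ t in (-1 : ℝ)..1, p.eval t
  map_add' p q := by
    simp only [Polynomial.eval_add]
    exact intervalIntegral.integral_add (p.continuous.intervalIntegrable _ _)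
      (q.continuous.intervalIntegrable _ _)
  map_smul' c p := by simp

lemma segmentIntegral_apply (p : Polynomial ℝ) :
    segmentIntegral p = ∫ t in (-1 : ℝ)..1, p.eval t := rfl

lemma EBilin_eq (f g : Polynomial ℝ) : EBilin f g = segmentIntegral
    (f.derivative.derivative * g.derivative.derivative + f.derivative * g.derivative) := by
  simp [EBilin, segmentIntegral_apply]

lemma FBilin_eq (f g : Polynomial ℝ) : FBilin f g = segmentIntegral (f * g) := by
  simp [FBilin, segmentIntegral_apply]

lemma EBilin_comm (f g : Polynomial ℝ) : EBilin f g = EBilin g f := by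
  simp only [EBilin_eq, mul_comm]

lemma FBilin_comm (f g : Polynomial ℝ) : FBilin f g = FBilin g f := by
  simp only [FBilin_eq, mul_comm]

lemma FBilin_legendreSum {W : ℕ} (b c : Fin (W + 1) → ℝ) :
    FBilin (legendreSum b) (legendreSum c) = b ⬝ᵥ (F W).mulVec c := by
  rw [FBilin_eq, legendreSum, legendreSum]
  simp only [← Polynomial.smul_eq_C_mul]
  rw [Finset.sum_mul_sum]
  simp only [map_sum, smul_mul_smul_comm, map_smul, dotProduct, Matrix.mulVec, F, Matrix.of_apply,
    Finset.mul_sum, smul_eq_mul, FBilin_eq]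
  exact Finset.sum_congr rfl fun i _ => Finset.sum_congr rfl fun j _ => by ring

lemma EBilin_legendreSum {W : ℕ} (b c : Fin (W + 1) → ℝ) :
    EBilin (legendreSum b) (legendreSum c) = b ⬝ᵥ (E W).mulVec c := by
  rw [EBilin_eq, legendreSum, legendreSum]
  simp only [← Polynomial.smul_eq_C_mul, Polynomial.derivative_sum, Polynomial.derivative_smul]
  rw [Finset.sum_mul_sum, Finset.sum_mul_sum]
  simp only [map_add, map_sum, smul_mul_smul_comm, map_smul, dotProduct, Matrix.mulVec, E,
    Matrix.of_apply, Finset.mul_sum, smul_eq_mul, EBilin_eq, ← Finset.sum_add_distrib]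
  exact Finset.sum_congr rfl fun i _ => Finset.sum_congr rfl fun j _ => by ring

lemma E_isSymm (W : ℕ) : (E W).IsSymm := Matrix.IsSymm.ext fun _ _ => EBilin_comm _ _

lemma EBilin_self_nonneg (f : Polynomial ℝ) : 0 ≤ EBilin f f :=
  intervalIntegral.integral_nonneg (by norm_num) fun t _ =>
    add_nonneg (mul_self_nonneg _) (mul_self_nonneg _)

lemma FBilin_self_pos {f : Polynomial ℝ} (hf : f ≠ 0) : 0 < FBilin f f := by
  obtain ⟨c, hc, hc0⟩ : ∃ c ∈ Set.Icc (-1 : ℝ) 1, f.eval c ≠ 0 := by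
    by_contra! h
    refine hf (Polynomial.eq_zero_of_infinite_isRoot f ((Set.Icc_infinite ?_).mono h))
    norm_num
  refine intervalIntegral.integral_pos (by norm_num) (by fun_prop)
    (fun t _ => mul_self_nonneg _) ⟨c, hc, mul_self_pos.2 hc0⟩

lemma F_posDef (W : ℕ) : (F W).PosDef := by
  refine .of_dotProduct_mulVec_pos ?_ fun b hb => ?_
  · ext i j
    simpa [F] using FBilin_comm _ _
  · rw [star_trivial, ← FBilin_legendreSum]
    exact FBilin_self_pos fun h => hb (legendreSum_eq_zero h)

variable {W : ℕ} {μ : Fin (W + 1) → ℝ} {b : Fin (W + 1) → Fin (W + 1) → ℝ}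

lemma IsEigensystem.dotProduct_E (h : IsEigensystem W μ b) (i j : Fin (W + 1)) :
    b i ⬝ᵥ (E W).mulVec (b j) = if i = j then μ i else 0 := by
  have h1 := h.1 j
  rw [Matrix.sub_mulVec, sub_eq_zero, Matrix.smul_mulVec] at h1
  rw [h1, dotProduct_smul, h.2]
  split_ifs with hij <;> simp [hij]

/-- By `F`-normalization, `μ i` is the value of the nonnegative form `𝓔` at the polynomial with
coefficients `b i`. -/
lemma IsEigensystem.nonneg (h : IsEigensystem W μ b) (i : Fin (W + 1)) : 0 ≤ μ i := by
  have h1 := h.dotProduct_E i i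
  rw [if_pos rfl, ← EBilin_legendreSum] at h1
  exact h1 ▸ EBilin_self_nonneg _

lemma IsEigensystem.FBilin_eq (h : IsEigensystem W μ b) (i j : Fin (W + 1)) :
    FBilin (legendreSum (b i)) (legendreSum (b j)) = if i = j then 1 else 0 := by
  rw [FBilin_legendreSum, h.2]

lemma IsEigensystem.EBilin_eq (h : IsEigensystem W μ b) (i j : Fin (W + 1)) :
    EBilin (legendreSum (b i)) (legendreSum (b j)) = if i = j then μ i else 0 := by
  rw [EBilin_legendreSum, h.dotProduct_E]

/-! ### Tensor products and diagonalization on the cube. -/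

/-- The tensor product of three polynomials in one variable. -/
def tensor (f g h : Polynomial ℝ) : MvPolynomial (Fin 3) ℝ :=
  Polynomial.aeval (MvPolynomial.X 0) f * Polynomial.aeval (MvPolynomial.X 1) g *
    Polynomial.aeval (MvPolynomial.X 2) h

lemma psi_eq_tensor (p : Fin (W + 1) × Fin (W + 1) × Fin (W + 1)) :
    psi b p = tensor (legendreSum (b p.1)) (legendreSum (b p.2.1)) (legendreSum (b p.2.2)) := rfl

lemma tensor_mul (f g h f' g' h' : Polynomial ℝ) :
    tensor f g h * tensor f' g' h' = tensor (f * f') (g * g') (h * h') := by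
  simp only [tensor, map_mul]
  ring

lemma eval_aeval_X (x : Fin 3 → ℝ) (i : Fin 3) (f : Polynomial ℝ) :
    MvPolynomial.eval x (Polynomial.aeval (MvPolynomial.X i) f) = f.eval (x i) := by
  induction f using Polynomial.induction_on' with
  | add p q hp hq => simp [hp, hq]
  | monomial n a => simp [Polynomial.aeval_monomial]

lemma pderiv_zero_tensor (f g h : Polynomial ℝ) :
    MvPolynomial.pderiv 0 (tensor f g h) = tensor f.derivative g h := by
  simp [tensor]
  ring

lemma pderiv_one_tensor (f g h : Polynomial ℝ) :
    MvPolynomial.pderiv 1 (tensor f g h) = tensor f g.derivative h := by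
  simp [tensor]
  ring

lemma pderiv_two_tensor (f g h : Polynomial ℝ) :
    MvPolynomial.pderiv 2 (tensor f g h) = tensor f g h.derivative := by
  simp [tensor]

lemma cubeIntegral_tensor (f g h : Polynomial ℝ) : cubeIntegral (tensor f g h) =
    segmentIntegral f * segmentIntegral g * segmentIntegral h := by
  simp only [segmentIntegral_apply, ← integral_Q_mul_mul, cubeIntegral_apply, tensor, map_mul,
    eval_aeval_X]

lemma L2Q_eq (f g : MvPolynomial (Fin 3) ℝ) : L2Q f g = cubeIntegral (f * g) := by
  simp only [L2Q, cubeIntegral_apply, map_mul]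

lemma L2Q_tensor (f g h f' g' h' : Polynomial ℝ) : L2Q (tensor f g h) (tensor f' g' h') =
    FBilin f f' * FBilin g g' * FBilin h h' := by
  simp only [L2Q_eq, tensor_mul, cubeIntegral_tensor, FBilin_eq]

lemma CBilin_tensor (f g h f' g' h' : Polynomial ℝ) : CBilin (tensor f g h) (tensor f' g' h') =
    EBilin f f' * FBilin g g' * FBilin h h' + FBilin f f' * EBilin g g' * FBilin h h' +
      FBilin f f' * FBilin g g' * EBilin h h' + FBilin f f' * FBilin g g' * FBilin h h' := by
  simp only [CBilin_eq, cPoly, Fin.sum_univ_three, pderiv_zero_tensor, pderiv_one_tensor,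
    pderiv_two_tensor, tensor_mul, map_add, cubeIntegral_tensor, EBilin_eq, FBilin_eq]
  ring

lemma IsEigensystem.L2Q_psi (h : IsEigensystem W μ b) (p q) :
    L2Q (psi b p) (psi b q) = if p = q then 1 else 0 := by
  simp only [psi_eq_tensor, L2Q_tensor, h.FBilin_eq, Prod.ext_iff]
  split_ifs <;> simp_all

lemma IsEigensystem.CBilin_psi (h : IsEigensystem W μ b) (p q) :
    CBilin (psi b p) (psi b q) = if p = q then muTensor μ p else 0 := by
  simp only [psi_eq_tensor, CBilin_tensor, h.FBilin_eq, h.EBilin_eq, muTensor, Prod.ext_iff]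
  split_ifs <;> simp_all

/-- `L2Q` as a bilinear map. -/
def L2QLin : MvPolynomial (Fin 3) ℝ →ₗ[ℝ] MvPolynomial (Fin 3) ℝ →ₗ[ℝ] ℝ :=
  LinearMap.mk₂ ℝ L2Q (fun _ _ _ => by simp only [L2Q_eq, add_mul, map_add])
    (fun _ _ _ => by simp only [L2Q_eq, smul_mul_assoc, map_smul])
    (fun _ _ _ => by simp only [L2Q_eq, mul_add, map_add])
    (fun _ _ _ => by simp only [L2Q_eq, mul_smul_comm, map_smul])

/-- `CBilin` as a bilinear map. -/
def CLin : MvPolynomial (Fin 3) ℝ →ₗ[ℝ] MvPolynomial (Fin 3) ℝ →ₗ[ℝ] ℝ :=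
  LinearMap.mk₂ ℝ CBilin
    (fun _ _ _ => by
      simp only [CBilin_eq, cPoly, Fin.sum_univ_three, add_mul, map_add]; ring)
    (fun _ _ _ => by
      simp only [CBilin_eq, cPoly, Fin.sum_univ_three, Derivation.map_smul,
        smul_mul_assoc, map_smul, map_add, smul_add])
    (fun _ _ _ => by
      simp only [CBilin_eq, cPoly, Fin.sum_univ_three, mul_add, map_add]; ring)
    (fun _ _ _ => by
      simp only [CBilin_eq, cPoly, Fin.sum_univ_three, Derivation.map_smul,
        mul_smul_comm, map_smul, map_add, smul_add])

lemma L2QLin_apply (f g : MvPolynomial (Fin 3) ℝ) : L2QLin f g = L2Q f g := rfl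

lemma CLin_apply (f g : MvPolynomial (Fin 3) ℝ) : CLin f g = CBilin f g := rfl

lemma IsEigensystem.linearIndependent_psi (h : IsEigensystem W μ b) :
    LinearIndependent ℝ (psi b) := by
  refine Fintype.linearIndependent_iff.2 fun c hc p => ?_
  have := congrArg (L2QLin (psi b p)) hc
  rw [map_zero] at this
  simpa [L2QLin_apply, h.L2Q_psi] using this

lemma degreeOf_aeval_X_le (i j : Fin 3) (f : Polynomial ℝ) :
    MvPolynomial.degreeOf i (Polynomial.aeval (MvPolynomial.X j : MvPolynomial (Fin 3) ℝ) f) ≤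
      if i = j then f.natDegree else 0 := by
  rw [Polynomial.aeval_eq_sum_range]
  refine (MvPolynomial.degreeOf_sum_le _ _ _).trans (Finset.sup_le fun n hn => ?_)
  rw [MvPolynomial.smul_eq_C_mul]
  refine (MvPolynomial.degreeOf_C_mul_le _ _ _).trans
    ((MvPolynomial.degreeOf_pow_le _ _ _).trans ?_)
  rw [MvPolynomial.degreeOf_X]
  split_ifs
  · simpa using Finset.mem_range_succ_iff.1 hn
  · simp

lemma tensor_mem_polySpace {f g h : Polynomial ℝ} (hf : f.natDegree ≤ W) (hg : g.natDegree ≤ W)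
    (hh : h.natDegree ≤ W) : tensor f g h ∈ PolySpace W := by
  rw [MvPolynomial.mem_restrictDegree]
  intro s hs i
  refine MvPolynomial.degreeOf_le_iff.1 ?_ s hs
  refine (MvPolynomial.degreeOf_mul_le _ _ _).trans ((Nat.add_le_add_right
    (MvPolynomial.degreeOf_mul_le _ _ _) _).trans ((add_le_add (add_le_add
      (degreeOf_aeval_X_le _ _ _) (degreeOf_aeval_X_le _ _ _)) (degreeOf_aeval_X_le _ _ _)).trans ?_))
  fin_cases i <;> simpa

/-- Serves as an upper bound `(W + 1)³` for the dimension in `span_psi`. -/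
lemma polySpace_le_span_monomials (W : ℕ) : PolySpace W ≤ Submodule.span ℝ
    (Set.range fun m : Fin 3 → Fin (W + 1) =>
      MvPolynomial.monomial (Finsupp.equivFunOnFinite.symm fun i => (m i : ℕ)) (1 : ℝ)) := by
  intro p hp
  rw [MvPolynomial.mem_restrictDegree] at hp
  rw [p.as_sum]
  refine Submodule.sum_mem _ fun s hs => ?_
  have e : MvPolynomial.monomial s (p.coeff s) = p.coeff s • MvPolynomial.monomial s (1 : ℝ) := by
    simp [MvPolynomial.smul_monomial]
  rw [e]
  refine Submodule.smul_mem _ _ (Submodule.subset_span ⟨fun i => ⟨s i, ?_⟩, ?_⟩)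
  · exact Nat.lt_succ_of_le (hp s hs i)
  · dsimp only
    congr 1
    ext i
    simp

/-- The `(W + 1)³` independent polynomials `psi b p` lie in `PolySpace W`, which sits inside the
span `T` of as many monomials; comparing dimensions forces all three spaces to coincide. -/
lemma IsEigensystem.span_psi (h : IsEigensystem W μ b) :
    Submodule.span ℝ (Set.range (psi b)) = PolySpace W := by
  have hle : Submodule.span ℝ (Set.range (psi b)) ≤ PolySpace W := by
    rw [Submodule.span_le]
    rintro _ ⟨p, rfl⟩
    exact tensor_mem_polySpace (natDegree_legendreSum_le _) (natDegree_legendreSum_le _)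
      (natDegree_legendreSum_le _)
  set T := Submodule.span ℝ (Set.range fun m : Fin 3 → Fin (W + 1) =>
      MvPolynomial.monomial (Finsupp.equivFunOnFinite.symm fun i => (m i : ℕ)) (1 : ℝ))
  have hPT : PolySpace W ≤ T := polySpace_le_span_monomials W
  have : FiniteDimensional ℝ T := FiniteDimensional.span_of_finite ℝ (Set.finite_range _)
  have hfin : Module.finrank ℝ T ≤ Module.finrank ℝ (Submodule.span ℝ (Set.range (psi b))) := by
    rw [finrank_span_eq_card h.linearIndependent_psi]
    refine (finrank_range_le_card _).trans_eq ?_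
    simp
    ring
  exact le_antisymm hle (hPT.trans (Submodule.eq_of_le_of_finrank_le (hle.trans hPT) hfin).ge)

/-- Both sides are linear in `v`, so it suffices to compare them on the spanning family `psi b`,
where orthogonality settles it. -/
lemma IsEigensystem.CBilin_psi_eq (h : IsEigensystem W μ b) (p) {v : MvPolynomial (Fin 3) ℝ}
    (hv : v ∈ PolySpace W) : CBilin (psi b p) v = muTensor μ p * L2Q (psi b p) v := by
  rw [← h.span_psi] at hv
  have hmaps : Set.EqOn (CLin (psi b p))
      (muTensor μ p • L2QLin (psi b p) : MvPolynomial (Fin 3) ℝ →ₗ[ℝ] ℝ)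
      (Set.range (psi b)) := by
    rintro _ ⟨q, rfl⟩
    simp [CLin_apply, L2QLin_apply, h.CBilin_psi, h.L2Q_psi]
  exact LinearMap.eqOn_span hmaps hv

lemma IsEigensystem.C_sum_psi (h : IsEigensystem W μ b)
    (c : Fin (W + 1) × Fin (W + 1) × Fin (W + 1) → ℝ) :
    C (∑ p, c p • psi b p) = ∑ p, muTensor μ p * c p ^ 2 := by
  rw [C_eq_CBilin, ← CLin_apply]
  simp only [map_sum, map_smul, LinearMap.sum_apply, LinearMap.smul_apply, CLin_apply,
    h.CBilin_psi, smul_eq_mul, mul_ite, mul_zero, Finset.sum_ite_eq',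
    Finset.mem_univ, if_true]
  exact Finset.sum_congr rfl fun p _ => by ring

end MasterCube

end

theorem theorem5p1 :
    -- spectral equivalence, with a constant independent of the degree
    (∃ L : ℝ, 0 < L ∧ ∀ W : ℕ, ∀ u ∈ MasterCube.PolySpace W,
      1 / L * MasterCube.B u ≤ MasterCube.C u ∧ MasterCube.C u ≤ MasterCube.B u) ∧
    ∀ W : ℕ,
      -- the matrices of the one-dimensional forms
      ((MasterCube.E W).IsSymm ∧ (MasterCube.F W).PosDef ∧
        ∀ b : Fin (W + 1) → ℝ,
          MasterCube.EBilin (MasterCube.legendreSum b) (MasterCube.legendreSum b) =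
            b ⬝ᵥ (MasterCube.E W).mulVec b ∧
          MasterCube.FBilin (MasterCube.legendreSum b) (MasterCube.legendreSum b) =
            b ⬝ᵥ (MasterCube.F W).mulVec b) ∧
      -- the generalized eigenvalue problem has a full ordered system
      (∃ (μ : Fin (W + 1) → ℝ) (b : Fin (W + 1) → Fin (W + 1) → ℝ),
        Monotone μ ∧ (∀ i, 0 ≤ μ i) ∧ MasterCube.IsEigensystem W μ b) ∧
      -- every such system diagonalizes the separable form
      ∀ (μ : Fin (W + 1) → ℝ) (b : Fin (W + 1) → Fin (W + 1) → ℝ),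
        MasterCube.IsEigensystem W μ b →
          (∀ i, 0 ≤ μ i) ∧
          (∀ i j, b i ⬝ᵥ (MasterCube.E W).mulVec (b j) = if i = j then μ i else 0) ∧
          LinearIndependent ℝ (MasterCube.psi b) ∧
          Submodule.span ℝ (Set.range (MasterCube.psi b)) = MasterCube.PolySpace W ∧
          (∀ p q, MasterCube.L2Q (MasterCube.psi b p) (MasterCube.psi b q) =
            if p = q then 1 else 0) ∧
          (∀ p q, MasterCube.CBilin (MasterCube.psi b p) (MasterCube.psi b q) =
            if p = q then MasterCube.muTensor μ p else 0) ∧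
          (∀ p, ∀ v ∈ MasterCube.PolySpace W, MasterCube.CBilin (MasterCube.psi b p) v =
            MasterCube.muTensor μ p * MasterCube.L2Q (MasterCube.psi b p) v) ∧
          ∀ c : Fin (W + 1) × Fin (W + 1) × Fin (W + 1) → ℝ,
            MasterCube.C (∑ p, c p • MasterCube.psi b p) =
              ∑ p, MasterCube.muTensor μ p * c p ^ 2 := by
  obtain ⟨L, hL, h⟩ := MasterCube.spectral_equivalence
  refine ⟨⟨L, hL, fun _ u _ => h u⟩, fun W => ⟨⟨MasterCube.E_isSymm W, MasterCube.F_posDef W,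
    fun b => ⟨MasterCube.EBilin_legendreSum b b, MasterCube.FBilin_legendreSum b b⟩⟩, ?_,
    fun μ b hb => ⟨hb.nonneg, hb.dotProduct_E, hb.linearIndependent_psi, hb.span_psi, hb.L2Q_psi,
      hb.CBilin_psi, fun p v hv => hb.CBilin_psi_eq p hv, hb.C_sum_psi⟩⟩⟩
  obtain ⟨μ, b, hμ, hb⟩ :=
    MasterCube.exists_generalized_eigensystem (MasterCube.E_isSymm W) (MasterCube.F_posDef W)
  exact ⟨μ, b, hμ, MasterCube.IsEigensystem.nonneg hb, hb⟩
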